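/- Let $\mathcal{X}$ be a set, let $a \le 0 < b$ be real numbers, and let $\mathcal{F}$ be a class of functions $\mathcal{X} \to [a,b]$ that contains the zero function. Let $n, m \ge 1$, let $\mathcal{S} = (s_1,\dots,s_m)$ be a fixed sample of elements of $\mathcal{X}$, and let $\boldsymbol\sigma = (\boldsymbol\sigma_{j,i})_{1\le j\le n,\,1\le i\le m}$ be a matrix of independent random variables, each equal to $1$ or $-1$ with probability $1/2$. Define the $n$-Monte Carlo empirical Rademacher average (MCERA) and the empirical Rademacher average (ERA) $$\hat R^n_m(\mathcal{F},\mathcal{S},\boldsymbol\sigma) = \frac1n\sum_{j=1}^n \sup_{f\in\mathcal{F}} \frac1m \sum_{i=1}^m \boldsymbol\sigma_{j,i} f(s_i), \qquad \hat R(\mathcal{F},\mathcal{S}) = \mathbb{E}_{\boldsymbol\sigma}\left[\hat R^n_m(\mathcal{F},\mathcal{S},\boldsymbol\sigma)\right],$$ and the empirical quantities $$\hat z = \sup_{1\le i\le m,\, f\in\mathcal{F}} |f(s_i)|, \qquad \hat\nu = \frac1m \sup_{f\in\mathcal{F}} \sum_{i=1}^m |f(s_i)|, \qquad \hat\sigma^2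 = \frac1m \sup_{f\in\mathcal{F}} \sum_{i=1}^m f(s_i)^2 .$$ Let $\delta \in (0,1]$. Then, with probability at least $1-\delta$ over $\boldsymbol\sigma$, $$\hat R(\mathcal{F},\mathcal{S}) \le \hat R^n_m(\mathcal{F},\mathcal{S},\boldsymbol\sigma) + \frac{2\hat z\ln(1/\delta)}{nm} + \sqrt{\left(\frac{2\hat z\ln(1/\delta)}{nm}\right)^2 + \frac{4\hat z\left(\hat R^n_m(\mathcal{F},\mathcal{S},\boldsymbol\sigma)+\hat\nu\right)\ln(1/\delta)}{nm}} .$$ Also, with probability at least $1-\delta$ over $\boldsymbol\sigma$, $$\hat R(\mathcal{F},\mathcal{S}) \le \hat R^n_m(\mathcal{F},\mathcal{S},\boldsymbol\sigma) + \frac{2\hat z\ln(1/\delta)}{nm} + \sqrt{\left(\frac{2\hat z\ln(1/\delta)}{nm}\right)^2 + \frac{4\left(\hat z\,\hat R^n_m(\mathcal{F},\mathcal{S},\boldsymbol\sigma)+\hat\sigma^2\right)\ln(1/\delta)}{nm}} .$$ -/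

import Mathlib

open MeasureTheory ProbabilityTheory

noncomputable section

/-- The `n`-Monte Carlo empirical Rademacher average of the class `F` on the sample `s` for the
`n × m` sign matrix `σ`. -/
def mcera {X : Type*} {n m : ℕ} (F : Set (X → ℝ)) (s : Fin m → X)
    (σ : Fin n → Fin m → ℝ) : ℝ :=
  (1 / (n : ℝ)) * ∑ j, ⨆ f : F, (1 / (m : ℝ)) * ∑ i, σ j i * (f : X → ℝ) (s i)

/-- `σ` is an `n × m` matrix of independent random signs, each equal to `1` or `-1` with
probability one half. -/
structure IsRademacherMatrix {Ω : Type*} [MeasurableSpace Ω] {n m : ℕ}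
    (σ : Fin n → Fin m → Ω → ℝ) (P : Measure Ω) : Prop where
  measurable : ∀ j i, Measurable (σ j i)
  indep : iIndepFun (fun (p : Fin n × Fin m) (ω : Ω) => σ p.1 p.2 ω) P
  prob_one : ∀ j i, P {ω | σ j i ω = 1} = 1 / 2
  prob_neg_one : ∀ j i, P {ω | σ j i ω = -1} = 1 / 2

/-- The empirical Rademacher average of `F` on the (fixed) sample `s`: the expectation of the
`n`-Monte Carlo empirical Rademacher average over the random sign matrix `σ`. -/
def era {X Ω : Type*} [MeasurableSpace Ω] {n m : ℕ} (F : Set (X → ℝ)) (s : Fin m → X)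
    (σ : Fin n → Fin m → Ω → ℝ) (P : Measure Ω) : ℝ :=
  ∫ ω, mcera F s (fun j i => σ j i ω) ∂P

/-- The empirical sup-norm `ẑ` of `F` on the sample. -/
def empSup {X : Type*} {m : ℕ} (F : Set (X → ℝ)) (s : Fin m → X) : ℝ :=
  ⨆ p : Fin m × F, |(p.2 : X → ℝ) (s p.1)|

/-- The supremum mean absolute value `ν̂` of `F` on the sample. -/
def empAbs {X : Type*} {m : ℕ} (F : Set (X → ℝ)) (s : Fin m → X) : ℝ :=
  (1 / (m : ℝ)) * ⨆ f : F, ∑ i, |(f : X → ℝ) (s i)|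

/-- The empirical wimpy variance `σ̂²` of `F` on the sample. -/
def empWimpyVar {X : Type*} {m : ℕ} (F : Set (X → ℝ)) (s : Fin m → X) : ℝ :=
  (1 / (m : ℝ)) * ⨆ f : F, ∑ i, (f : X → ℝ) (s i) ^ 2

end

/-!
The MCERA is the supremum over a set `T` of vectors of the inner product with the random sign
matrix. Reversing one sign changes such a supremum by at most twice a coordinate of a vector of `T`
attaining it, so for the supremum `Y` the sum of the squared decreases over all single reversals is
at most four times the largest squared length in `T`. Tensorization of entropy and a two-point
inequality turn this into a differential inequality for `log 𝔼[exp (-t Y)]`, and Herbst's argument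
bounds the lower tail of `Y` by `exp (-u ^ 2 / (4 * (ζ * 𝔼[Y] + v)))`, where `ζ` and `v` bound the
coordinates and the squared lengths in `T`: the term `ζ * 𝔼[Y]` pays for the factor
`exp (2 * ζ * t)` that is lost in the exponential when a sign is reversed. Solving the resulting
quadratic inequality for `𝔼[Y]` gives the empirical form of the bound.
-/

open scoped BigOperators

section Entropy

open Finset Real

variable {α β : Type*} [Fintype α] [Fintype β]

/-- The entropy `𝔼[f log f] - 𝔼[f] log 𝔼[f]` of a positive function on a finite probability space,
the space being a finite type with its uniform distribution. -/
noncomputable def entropy (f : α → ℝ) : ℝ :=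
  𝔼 a, f a * log (f a) - (𝔼 a, f a) * log (𝔼 a, f a)

theorem entropy_const [Nonempty α] (c : ℝ) : entropy (fun _ : α => c) = 0 := by
  simp [entropy]

theorem expect_mul_log_sub_log_le_entropy [Nonempty α] {f g : α → ℝ} (hf : ∀ a, 0 < f a)
    (hg : ∀ a, 0 < g a) : 𝔼 a, f a * (log (g a) - log (𝔼 b, g b)) ≤ entropy f := by
  set A := 𝔼 a, f a with hA
  set B := 𝔼 a, g a with hB
  have hApos : 0 < A := expect_pos (fun a _ => hf a) univ_nonempty
  have hBpos : 0 < B := expect_pos (fun a _ => hg a) univ_nonempty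
  have gibbs (a : α) : f a * (log (g a) - log B) ≤
      f a * log (f a) - f a * log A + (g a * (A / B) - f a) := by
    have hfa := hf a
    have hga := hg a
    have h := log_le_sub_one_of_pos (x := g a * A / (f a * B)) (by positivity)
    rw [log_div (by positivity) (by positivity), log_mul hga.ne' hApos.ne',
      log_mul hfa.ne' hBpos.ne'] at h
    have h' : f a * (g a * A / (f a * B) - 1) = g a * (A / B) - f a := by field_simp
    linarith [mul_le_mul_of_nonneg_left h hfa.le]
  calc 𝔼 a, f a * (log (g a) - log B)
      ≤ 𝔼 a, (f a * log (f a) - f a * log A + (g a * (A / B) - f a)) :=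
        expect_le_expect fun a _ => gibbs a
    _ = entropy f + (B * (A / B) - A) := by
        simp only [expect_add_distrib, expect_sub_distrib, ← expect_mul, entropy, ← hA, ← hB]
    _ = entropy f := by rw [mul_div_cancel₀ A hBpos.ne', sub_self, add_zero]

-- By duality, entropy is a supremum of linear functionals.
theorem entropy_expect_le_expect_entropy [Nonempty α] [Nonempty β] {f : β → α → ℝ}
    (hf : ∀ b a, 0 < f b a) : entropy (fun a => 𝔼 b, f b a) ≤ 𝔼 b, entropy (f b) := by
  let g (a : α) : ℝ := 𝔼 b, f b a
  have hgpos (a : α) : 0 < g a := expect_pos (fun b _ => hf b a) univ_nonempty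
  calc entropy g = 𝔼 a, g a * (log (g a) - log (𝔼 a, g a)) := by
        simp only [entropy, mul_sub, expect_sub_distrib, ← expect_mul]
    _ = 𝔼 a, 𝔼 b, f b a * (log (g a) - log (𝔼 a, g a)) := by
        simp only [← expect_mul, g]
    _ = 𝔼 b, 𝔼 a, f b a * (log (g a) - log (𝔼 a, g a)) := expect_comm ..
    _ ≤ 𝔼 b, entropy (f b) :=
        expect_le_expect fun b _ => expect_mul_log_sub_log_le_entropy (hf b) hgpos

theorem entropy_le_expect_mul_log_sub [Nonempty α] {f : α → ℝ} (hf : ∀ a, 0 < f a) {u : ℝ}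
    (hu : 0 < u) : entropy f ≤ 𝔼 a, (f a * (log (f a) - log u) - (f a - u)) := by
  have hA : 0 < 𝔼 a, f a := expect_pos (fun a _ => hf a) univ_nonempty
  have h : (𝔼 a, f a) * log u ≤ (𝔼 a, f a) * log (𝔼 a, f a) + u - 𝔼 a, f a := by
    have h := mul_le_mul_of_nonneg_left (log_le_sub_one_of_pos (div_pos hu hA)) hA.le
    rw [log_div hu.ne' hA.ne', mul_sub, mul_sub, mul_div_cancel₀ u hA.ne'] at h
    linarith
  simp only [mul_sub, expect_sub_distrib, ← expect_mul, Fintype.expect_const, entropy]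
  linarith

end Entropy

section Tensorization

open Finset Function Real

variable {ι : Type*} [Fintype ι] [DecidableEq ι] {κ : ι → Type*} [∀ i, Fintype (κ i)]

/-- The conditional expectation of `f` given the coordinates outside `s`: the coordinates in `s`
are averaged over. It interpolates between `f` and its mean in the tensorization of entropy. -/
noncomputable def partialExpect (s : Finset ι) (f : (∀ i, κ i) → ℝ) (ε : ∀ i, κ i) : ℝ :=
  𝔼 η, f (s.piecewise η ε)

theorem partialExpect_update {s : Finset ι} {i : ι} (hi : i ∉ s) (f : (∀ i, κ i) → ℝ)
    (ε : ∀ i, κ i) (k : κ i) :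
    partialExpect s f (update ε i k) = 𝔼 η, f (update (s.piecewise η ε) i k) := by
  simp only [partialExpect, update_piecewise_of_notMem _ _ _ hi]

theorem partialExpect_univ (f : (∀ i, κ i) → ℝ) : partialExpect univ f = fun _ => 𝔼 ε, f ε := by
  funext ε
  simp only [partialExpect, piecewise_univ]

variable [∀ i, Nonempty (κ i)]

theorem partialExpect_empty (f : (∀ i, κ i) → ℝ) : partialExpect ∅ f = f := by
  funext ε
  simp only [partialExpect, piecewise_empty, Fintype.expect_const]

theorem expect_expect_update (i : ι) (f : (∀ i, κ i) → ℝ) :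
    𝔼 ε, 𝔼 k, f (update ε i k) = 𝔼 ε, f ε := by
  have swap_involutive : Involutive fun p : (∀ i, κ i) × κ i => (update p.1 i p.2, p.1 i) := by
    rintro ⟨ε, k⟩
    simp
  have h := Fintype.expect_bijective _ swap_involutive.bijective
    (fun p => f (update p.1 i p.2)) (fun p => f p.1) fun _ => rfl
  simpa only [← univ_product_univ, expect_product, Fintype.expect_const] using h

theorem expect_expect_piecewise (s : Finset ι) (f : (∀ i, κ i) → ℝ) :
    𝔼 ε, 𝔼 η, f (s.piecewise η ε) = 𝔼 ε, f ε := by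
  have swap_involutive : Involutive fun p : (∀ i, κ i) × (∀ i, κ i) =>
      (s.piecewise p.2 p.1, s.piecewise p.1 p.2) := by
    rintro ⟨ε, η⟩
    simp [piecewise_same]
  have h := Fintype.expect_bijective _ swap_involutive.bijective
    (fun p => f (s.piecewise p.2 p.1)) (fun p => f p.1) fun _ => rfl
  simpa only [← univ_product_univ, expect_product, Fintype.expect_const] using h

theorem partialExpect_insert {s : Finset ι} {i : ι} (hi : i ∉ s) (f : (∀ i, κ i) → ℝ) :
    partialExpect (insert i s) f = fun ε => 𝔼 k, partialExpect s f (update ε i k) := by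
  funext ε
  calc partialExpect (insert i s) f ε = 𝔼 η, f (update (s.piecewise η ε) i (η i)) := by
        simp only [partialExpect, piecewise_insert]
    _ = 𝔼 η, 𝔼 k, f (update (s.piecewise (update η i k) ε) i k) := by
        rw [← expect_expect_update i]
        simp only [update_self]
    _ = 𝔼 η, 𝔼 k, f (update (s.piecewise η ε) i k) := by
        have h (η : ∀ i, κ i) (k : κ i) :
            s.piecewise (update η i k) ε = s.piecewise η ε :=
          s.piecewise_congr (fun j hj => update_of_ne (ne_of_mem_of_not_mem hj hi) _ _)
            fun _ _ => rfl
        simp only [h]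
    _ = 𝔼 k, partialExpect s f (update ε i k) := by
        rw [expect_comm]
        simp only [partialExpect_update hi]

theorem entropy_eq_entropy_expect_update_add (i : ι) (f : (∀ i, κ i) → ℝ) :
    entropy f = entropy (fun ε => 𝔼 k, f (update ε i k))
      + 𝔼 ε, entropy fun k => f (update ε i k) := by
  simp only [entropy, expect_sub_distrib, expect_expect_update i fun ε => f ε * log (f ε),
    expect_expect_update i f]
  ring

theorem expect_entropy_partialExpect_update_le {s : Finset ι} {i : ι} (hi : i ∉ s)
    {f : (∀ i, κ i) → ℝ} (hf : ∀ ε, 0 < f ε) :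
    𝔼 ε, entropy (fun k => partialExpect s f (update ε i k))
      ≤ 𝔼 ε, entropy fun k => f (update ε i k) := by
  simp only [partialExpect_update hi]
  rw [← expect_expect_piecewise s fun ε => entropy fun k => f (update ε i k)]
  exact expect_le_expect fun ε _ => entropy_expect_le_expect_entropy fun _ _ => hf _

theorem entropy_le_entropy_partialExpect_add {f : (∀ i, κ i) → ℝ} (hf : ∀ ε, 0 < f ε)
    (s : Finset ι) :
    entropy f ≤ entropy (partialExpect s f)
      + ∑ i ∈ s, 𝔼 ε, entropy fun k => f (update ε i k) := by
  induction s using Finset.induction_on with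
  | empty => simp only [partialExpect_empty, sum_empty, add_zero, le_refl]
  | insert i s hi ih =>
    have chain := entropy_eq_entropy_expect_update_add i (partialExpect s f)
    rw [← partialExpect_insert hi] at chain
    rw [sum_insert hi]
    linarith [expect_entropy_partialExpect_update_le hi hf]

theorem entropy_le_sum_expect_entropy_update {f : (∀ i, κ i) → ℝ} (hf : ∀ ε, 0 < f ε) :
    entropy f ≤ ∑ i, 𝔼 ε, entropy fun k => f (update ε i k) := by
  simpa only [partialExpect_univ, entropy_const, zero_add] using
    entropy_le_entropy_partialExpect_add hf univ

end Tensorization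

section SignCube

open Finset Function Real

variable {ι : Type*}

/-- The real vector of the signs `ε`. -/
noncomputable def signVec (ε : ι → ℤˣ) (i : ι) : ℝ :=
  (ε i : ℤ)

theorem signVec_injective : Injective (signVec : (ι → ℤˣ) → ι → ℝ) := fun _ _ h =>
  funext fun i => Units.ext (Int.cast_injective (congrFun h i))

theorem signVec_sq (ε : ι → ℤˣ) (i : ι) : signVec ε i ^ 2 = 1 := by
  rcases Int.units_eq_one_or (ε i) with h | h <;> simp [signVec, h]

variable [DecidableEq ι]

/-- The sign vector `ε` with its `i`-th sign reversed: the neighbour of `ε` in direction `i` on the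
cube `{1, -1} ^ ι`. The cube is encoded as `ι → ℤˣ`. -/
def flipAt (i : ι) (ε : ι → ℤˣ) : ι → ℤˣ :=
  update ε i (-ε i)

theorem flipAt_involutive (i : ι) : Involutive (flipAt i) := fun ε => by
  simp [flipAt]

theorem signVec_sub_signVec_flipAt (i : ι) (ε : ι → ℤˣ) :
    signVec ε - signVec (flipAt i ε) = Pi.single i (2 * signVec ε i) := by
  funext j
  rcases eq_or_ne j i with rfl | hj
  · simp only [signVec, flipAt, Pi.sub_apply, update_self, Units.val_neg, Int.cast_neg,
      Pi.single_eq_same]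
    ring
  · simp [signVec, flipAt, hj]

theorem expect_flipAt [Fintype ι] (i : ι) (f : (ι → ℤˣ) → ℝ) :
    𝔼 ε, f (flipAt i ε) = 𝔼 ε, f ε :=
  Fintype.expect_bijective _ (flipAt_involutive i).bijective _ _ fun _ => rfl

theorem expect_units_int (h : ℤˣ → ℝ) (u : ℤˣ) : 𝔼 v, h v = (h u + h (-u)) / 2 := by
  have h₁ : 𝔼 v, h v = (h 1 + h (-1)) / 2 := by
    rw [Fintype.expect_eq_sum_div_card, UnitsInt.univ, sum_pair (by decide)]
    simp
  rcases Int.units_eq_one_or u with rfl | rfl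
  · exact h₁
  · rw [h₁, neg_neg, add_comm]

theorem exp_div_two_sq (x : ℝ) : exp (x / 2) ^ 2 = exp x := by
  rw [← exp_nat_mul, Nat.cast_ofNat, mul_div_cancel₀ x two_ne_zero]

theorem exp_log_mean_sub_le {x y : ℝ} (hxy : y ≤ x) :
    (x - y) * (exp (-y) - exp (-x)) / 4 - (exp (-y / 2) - exp (-x / 2)) ^ 2 / 2
      ≤ (x - y) ^ 2 * exp (-y) / 8 := by
  rw [← exp_div_two_sq (-x), ← exp_div_two_sq (-y)]
  set p := exp (-x / 2)
  set q := exp (-y / 2)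
  nlinarith [sq_nonneg ((x - y) / 2 * q - (q - p)),
    mul_nonneg (sub_nonneg.2 hxy) (sq_nonneg (q - p))]

theorem entropy_exp_neg_units_int_le_of_le (h : ℤˣ → ℝ) {u : ℤˣ} (hu : h (-u) ≤ h u) :
    entropy (fun v => exp (-h v)) ≤ (h u - h (-u)) ^ 2 * exp (-h (-u)) / 8 := by
  have geometric_mean : exp (-(h u + h (-u)) / 2) = exp (-h u / 2) * exp (-h (-u) / 2) := by
    rw [← exp_add]
    ring_nf
  -- The variational formula is applied at the geometric mean of the two values.
  refine (entropy_le_expect_mul_log_sub (fun v => exp_pos (-h v))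
    (exp_pos (-(h u + h (-u)) / 2))).trans (le_trans (le_of_eq ?_) (exp_log_mean_sub_le hu))
  rw [expect_units_int _ u]
  simp only [log_exp]
  rw [geometric_mean, ← exp_div_two_sq (-h u), ← exp_div_two_sq (-h (-u))]
  ring

theorem entropy_exp_neg_units_int_le (h : ℤˣ → ℝ) (u : ℤˣ) :
    entropy (fun v => exp (-h v)) ≤
      ((h u - h (-u))⁺ ^ 2 * exp (-h (-u)) + (h (-u) - h u)⁺ ^ 2 * exp (-h u)) / 8 := by
  rcases le_total (h (-u)) (h u) with hu | hu
  · rw [posPart_of_nonneg (sub_nonneg.2 hu), posPart_of_nonpos (sub_nonpos.2 hu)]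
    linarith [entropy_exp_neg_units_int_le_of_le h hu]
  · rw [posPart_of_nonpos (sub_nonpos.2 hu), posPart_of_nonneg (sub_nonneg.2 hu)]
    have := entropy_exp_neg_units_int_le_of_le h (u := -u) (by rwa [neg_neg])
    rw [neg_neg] at this
    linarith

variable [Fintype ι]

theorem entropy_exp_neg_le (Z : (ι → ℤˣ) → ℝ) :
    entropy (fun ε => exp (-Z ε)) ≤
      (𝔼 ε, ∑ i, (Z ε - Z (flipAt i ε))⁺ ^ 2 * exp (-Z (flipAt i ε))) / 4 := by
  have coordinate (i : ι) : 𝔼 ε, entropy (fun k => exp (-Z (update ε i k))) ≤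
      (𝔼 ε, (Z ε - Z (flipAt i ε))⁺ ^ 2 * exp (-Z (flipAt i ε))) / 4 := by
    have symm := expect_flipAt i fun ε => (Z ε - Z (flipAt i ε))⁺ ^ 2 * exp (-Z (flipAt i ε))
    simp only [flipAt_involutive i _] at symm
    calc 𝔼 ε, entropy (fun k => exp (-Z (update ε i k)))
        ≤ 𝔼 ε, ((Z ε - Z (flipAt i ε))⁺ ^ 2 * exp (-Z (flipAt i ε))
            + (Z (flipAt i ε) - Z ε)⁺ ^ 2 * exp (-Z ε)) / 8 := by
          refine expect_le_expect fun ε _ => ?_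
          simpa only [update_eq_self, flipAt] using
            entropy_exp_neg_units_int_le (fun k => Z (update ε i k)) (ε i)
      _ = (𝔼 ε, (Z ε - Z (flipAt i ε))⁺ ^ 2 * exp (-Z (flipAt i ε))) / 4 := by
          rw [← expect_div, expect_add_distrib, symm]
          ring
  refine (entropy_le_sum_expect_entropy_update fun ε => exp_pos (-Z ε)).trans ?_
  rw [expect_sum_comm, sum_div]
  exact sum_le_sum fun i _ => coordinate i

theorem entropy_exp_neg_le_of_sum_sq_le {Z : (ι → ℤˣ) → ℝ} {V K : ℝ}
    (hV : ∀ ε, ∑ i, (Z ε - Z (flipAt i ε))⁺ ^ 2 ≤ V) (hK : ∀ ε i, Z ε - Z (flipAt i ε) ≤ K) :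
    entropy (fun ε => exp (-Z ε)) ≤ V * exp K / 4 * 𝔼 ε, exp (-Z ε) := by
  have pointwise (ε : ι → ℤˣ) : ∑ i, (Z ε - Z (flipAt i ε))⁺ ^ 2 * exp (-Z (flipAt i ε))
      ≤ V * (exp K * exp (-Z ε)) :=
    calc ∑ i, (Z ε - Z (flipAt i ε))⁺ ^ 2 * exp (-Z (flipAt i ε))
        ≤ ∑ i, (Z ε - Z (flipAt i ε))⁺ ^ 2 * (exp K * exp (-Z ε)) := by
          refine sum_le_sum fun i _ => mul_le_mul_of_nonneg_left ?_ (sq_nonneg _)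
          rw [← exp_add]
          exact exp_le_exp.2 (by linarith [hK ε i])
      _ ≤ V * (exp K * exp (-Z ε)) := by
          rw [← sum_mul]
          exact mul_le_mul_of_nonneg_right (hV ε) (by positivity)
  calc entropy (fun ε => exp (-Z ε))
      ≤ (𝔼 ε, V * (exp K * exp (-Z ε))) / 4 :=
        (entropy_exp_neg_le Z).trans <| by
          gcongr with ε
          exact pointwise ε
    _ = V * exp K / 4 * 𝔼 ε, exp (-Z ε) := by
        rw [← mul_expect, ← mul_expect]
        ring

end SignCube

section Herbst

open Finset Function Real

-- `L t / t - C * t` is nonincreasing, and `L t / t` tends to `L' 0` at `0`.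
theorem le_of_mul_deriv_sub_le {L L' : ℝ → ℝ} {l C : ℝ} (hl : 0 < l)
    (hL : ∀ t, HasDerivAt L (L' t) t) (hL0 : L 0 = 0)
    (hLC : ∀ t, 0 < t → t ≤ l → t * L' t - L t ≤ C * t ^ 2) : L l ≤ l * L' 0 + C * l ^ 2 := by
  have slope_eq {t : ℝ} (ht : 0 < t) : dslope L 0 t = L t / t := by
    rw [dslope_of_ne _ ht.ne', slope_def_field, hL0, sub_zero, sub_zero]
  have deriv_slope {t : ℝ} (ht : 0 < t) :
      HasDerivAt (fun t => dslope L 0 t - C * t) ((L' t * t - L t * 1) / t ^ 2 - C * 1) t := by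
    refine HasDerivAt.sub ?_ ((hasDerivAt_id t).const_mul C)
    refine ((hL t).div (hasDerivAt_id t) ht.ne').congr_of_eventuallyEq ?_
    filter_upwards [lt_mem_nhds ht] with t ht using slope_eq ht
  have anti : AntitoneOn (fun t => dslope L 0 t - C * t) (Set.Icc 0 l) := by
    refine antitoneOn_of_hasDerivWithinAt_nonpos
      (f' := fun t => (L' t * t - L t * 1) / t ^ 2 - C * 1) (convex_Icc 0 l) ?_ ?_ ?_
    · intro t ht
      rcases ht.1.eq_or_lt with rfl | ht
      · exact ((continuousAt_dslope_same.2 (hL 0).differentiableAt).sub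
          (by fun_prop)).continuousWithinAt
      · exact (deriv_slope ht).continuousAt.continuousWithinAt
    · rw [interior_Icc]
      exact fun t ht => (deriv_slope ht.1).hasDerivWithinAt
    · rw [interior_Icc]
      intro t ht
      have := hLC t ht.1 ht.2.le
      rw [sub_nonpos, div_le_iff₀ (pow_pos ht.1 2)]
      linarith
  have h := anti (Set.left_mem_Icc.2 hl.le) (Set.right_mem_Icc.2 hl.le) hl.le
  simp only [slope_eq hl, dslope_same, (hL 0).deriv, mul_zero, sub_zero] at h
  rw [sub_le_iff_le_add, div_le_iff₀ hl] at h
  linarith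

variable {α : Type*} [Fintype α]

theorem hasDerivAt_expect_exp_neg_mul (f : α → ℝ) (t : ℝ) :
    HasDerivAt (fun t => 𝔼 a, exp (-(t * f a))) (-𝔼 a, f a * exp (-(t * f a))) t := by
  simp only [Fintype.expect_eq_sum_div_card, ← neg_div, ← sum_neg_distrib]
  refine (HasDerivAt.fun_sum fun a _ => ?_).div_const _
  exact (hasDerivAt_mul_const (f a)).fun_neg.exp.congr_deriv (by ring)

theorem dens_le_le_exp_mul_expect (f : α → ℝ) (c : ℝ) {l : ℝ} (hl : 0 ≤ l) :
    (({a | f a ≤ c} : Finset α).dens : ℝ) ≤ exp (l * c) * 𝔼 a, exp (-(l * f a)) := by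
  have markov (a : α) : (if f a ≤ c then 1 else 0 : ℝ) ≤ exp (l * c) * exp (-(l * f a)) := by
    split_ifs with ha
    · rw [← exp_add]
      exact one_le_exp (by linarith [mul_le_mul_of_nonneg_left ha hl])
    · positivity
  calc (({a | f a ≤ c} : Finset α).dens : ℝ) = 𝔼 a, if f a ≤ c then 1 else 0 := by
        rw [nnratCast_dens, Fintype.expect_eq_sum_div_card, sum_boole]
    _ ≤ exp (l * c) * 𝔼 a, exp (-(l * f a)) := by
        rw [mul_expect]
        exact expect_le_expect fun a _ => markov a

variable [Nonempty α]

-- Herbst's argument: divided by `𝔼 exp (-t f)`, the entropy of `exp (-t f)` is `t L' t - L t`,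
-- where `L t = log (𝔼 exp (-t f))`.
theorem expect_exp_neg_mul_le_of_entropy_le {f : α → ℝ} {l C : ℝ} (hl : 0 < l)
    (hC : ∀ t, 0 < t → t ≤ l →
      entropy (fun a => exp (-(t * f a))) ≤ C * t ^ 2 * 𝔼 a, exp (-(t * f a))) :
    𝔼 a, exp (-(l * f a)) ≤ exp (-(l * 𝔼 a, f a) + C * l ^ 2) := by
  have hpos (t : ℝ) : 0 < 𝔼 a, exp (-(t * f a)) := expect_pos (fun a _ => exp_pos _) univ_nonempty
  have h := le_of_mul_deriv_sub_le hl (C := C)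
    (fun t => (hasDerivAt_expect_exp_neg_mul f t).log (hpos t).ne') (by simp) fun t ht htl => by
      have entropy_eq : entropy (fun a => exp (-(t * f a))) =
          t * (-𝔼 a, f a * exp (-(t * f a)))
            - (𝔼 a, exp (-(t * f a))) * log (𝔼 a, exp (-(t * f a))) := by
        simp only [entropy, log_exp, ← mul_neg, mul_expect, ← expect_neg_distrib]
        ring_nf
      have := hC t ht htl
      rw [entropy_eq] at this
      rw [← mul_le_mul_iff_left₀ (hpos t), sub_mul, ← mul_div_assoc, div_mul_cancel₀ _ (hpos t).ne']
      linarith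
  rw [← exp_log (hpos l)]
  refine exp_le_exp.2 (h.trans (le_of_eq ?_))
  simp

end Herbst

section LowerTail

open Finset Real

variable {ι : Type*} [Fintype ι] [DecidableEq ι] {Y : (ι → ℤˣ) → ℝ} {V K : ℝ}

theorem expect_exp_neg_mul_le_of_sum_sq_le
    (hV : ∀ ε, ∑ i, (Y ε - Y (flipAt i ε))⁺ ^ 2 ≤ V) (hK : ∀ ε i, Y ε - Y (flipAt i ε) ≤ K)
    (hK0 : 0 ≤ K) {l : ℝ} (hl : 0 < l) :
    𝔼 ε, exp (-(l * Y ε)) ≤ exp (-(l * 𝔼 ε, Y ε) + V * exp (l * K) / 4 * l ^ 2) := by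
  have hV0 : 0 ≤ V := (sum_nonneg fun i _ => sq_nonneg _).trans (hV 1)
  refine expect_exp_neg_mul_le_of_entropy_le hl fun t ht htl => ?_
  have entropy_le := entropy_exp_neg_le_of_sum_sq_le (Z := fun ε => t * Y ε) (V := t ^ 2 * V)
    (K := t * K) (fun ε => ?_) fun ε i => ?_
  · refine entropy_le.trans (mul_le_mul_of_nonneg_right ?_ (expect_nonneg fun ε _ => exp_nonneg _))
    calc t ^ 2 * V * exp (t * K) / 4 ≤ t ^ 2 * V * exp (l * K) / 4 := by gcongr
      _ = V * exp (l * K) / 4 * t ^ 2 := by ring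
  · have posPart_mul (x : ℝ) : (t * x)⁺ = t * x⁺ := by
      rw [posPart_def, posPart_def, mul_max_of_nonneg _ _ ht.le, mul_zero]
    simp only [← mul_sub, posPart_mul, mul_pow, ← mul_sum]
    exact mul_le_mul_of_nonneg_left (hV ε) (sq_nonneg t)
  · rw [← mul_sub]
    exact mul_le_mul_of_nonneg_left (hK ε i) ht.le

theorem dens_le_expect_sub_le_exp
    (hV : ∀ ε, ∑ i, (Y ε - Y (flipAt i ε))⁺ ^ 2 ≤ V) (hK : ∀ ε i, Y ε - Y (flipAt i ε) ≤ K)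
    (hK0 : 0 ≤ K) (hW : 0 < V + 2 * K * 𝔼 ε, Y ε) {T : ℝ} (hT : 0 < T) (hTY : T ≤ 𝔼 ε, Y ε) :
    (({ε | Y ε ≤ 𝔼 ε, Y ε - T} : Finset (ι → ℤˣ)).dens : ℝ)
      ≤ exp (-(T ^ 2 / (V + 2 * K * 𝔼 ε, Y ε))) := by
  set R := 𝔼 ε, Y ε
  set W := V + 2 * K * R with hWdef
  set l := 2 * T / W with hl
  have hl0 : 0 < l := by positivity
  have variance_le : V * exp (l * K) ≤ W := by
    have h : V / W ≤ exp (-(l * K)) :=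
      calc V / W = 1 - 2 * R / W * K := by
            rw [eq_sub_of_add_eq hWdef.symm]
            field_simp
        _ ≤ 1 - l * K := by
            rw [hl]
            gcongr
        _ ≤ exp (-(l * K)) := one_sub_le_exp_neg _
    rwa [exp_neg, div_le_iff₀ hW, inv_mul_eq_div, le_div_iff₀ (exp_pos _)] at h
  calc (({ε | Y ε ≤ R - T} : Finset (ι → ℤˣ)).dens : ℝ)
      ≤ exp (l * (R - T)) * 𝔼 ε, exp (-(l * Y ε)) := dens_le_le_exp_mul_expect Y _ hl0.le
    _ ≤ exp (l * (R - T)) * exp (-(l * R) + V * exp (l * K) / 4 * l ^ 2) := by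
        gcongr
        exact expect_exp_neg_mul_le_of_sum_sq_le hV hK hK0 hl0
    _ ≤ exp (l * (R - T)) * exp (-(l * R) + W / 4 * l ^ 2) := by gcongr
    _ = exp (-(T ^ 2 / W)) := by
        rw [← exp_add, hl]
        congr 1
        field_simp
        ring

end LowerTail

section SupportFn

open Finset Function Real

variable {ι : Type*} [Fintype ι] {T : Set (ι → ℝ)}

/-- The support function `τ ↦ sup {⟪τ, t⟫ | t ∈ T}` of a set `T` of vectors. Its values at random
sign vectors form the Rademacher process of `T`. -/
noncomputable def supportFn (T : Set (ι → ℝ)) (τ : ι → ℝ) : ℝ :=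
  ⨆ t : T, τ ⬝ᵥ t

theorem dotProduct_le_supportFn (hT : Bornology.IsBounded T) (τ : ι → ℝ) {t : ι → ℝ}
    (ht : t ∈ closure T) : τ ⬝ᵥ t ≤ supportFn T τ := by
  have hcont : Continuous fun t : ι → ℝ => τ ⬝ᵥ t := by fun_prop
  have hbdd : BddAbove (Set.range fun t : T => τ ⬝ᵥ (t : ι → ℝ)) := by
    rw [← Set.image_eq_range]
    exact (hT.isCompact_closure.bddAbove_image hcont.continuousOn).mono
      (Set.image_mono subset_closure)
  exact closure_minimal (fun t ht => le_ciSup hbdd ⟨t, ht⟩)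
    (isClosed_le hcont continuous_const) ht

theorem exists_mem_closure_supportFn_eq (hT : Bornology.IsBounded T) (hne : T.Nonempty)
    (τ : ι → ℝ) : ∃ t ∈ closure T, supportFn T τ = τ ⬝ᵥ t := by
  have := hne.to_subtype
  have hcont : Continuous fun t : ι → ℝ => τ ⬝ᵥ t := by fun_prop
  obtain ⟨t, ht, hmax⟩ := hT.isCompact_closure.exists_isMaxOn hne.closure hcont.continuousOn
  exact ⟨t, ht, le_antisymm (ciSup_le fun u => hmax (subset_closure u.2))
    (dotProduct_le_supportFn hT τ ht)⟩

theorem supportFn_nonneg (hT : Bornology.IsBounded T) (h0 : 0 ∈ T) (τ : ι → ℝ) :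
    0 ≤ supportFn T τ := by
  simpa only [dotProduct_zero] using dotProduct_le_supportFn hT τ (subset_closure h0)

theorem supportFn_eq_zero_of_dotProduct_self_le_zero (hne : T.Nonempty)
    (hv : ∀ t ∈ T, t ⬝ᵥ t ≤ 0) (τ : ι → ℝ) : supportFn T τ = 0 := by
  have := hne.to_subtype
  have hT (t : T) : (t : ι → ℝ) = 0 :=
    dotProduct_self_eq_zero.1 ((hv t t.2).antisymm (by simpa using dotProduct_star_self_nonneg t.1))
  simp only [supportFn, hT, dotProduct_zero, ciSup_const]

variable [DecidableEq ι]

theorem exists_mem_closure_supportFn_sub_le (hT : Bornology.IsBounded T) (hne : T.Nonempty)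
    (ε : ι → ℤˣ) : ∃ t ∈ closure T, ∀ i,
      supportFn T (signVec ε) - supportFn T (signVec (flipAt i ε)) ≤ 2 * signVec ε i * t i := by
  obtain ⟨t, ht, hmax⟩ := exists_mem_closure_supportFn_eq hT hne (signVec ε)
  refine ⟨t, ht, fun i => ?_⟩
  calc supportFn T (signVec ε) - supportFn T (signVec (flipAt i ε))
      ≤ signVec ε ⬝ᵥ t - signVec (flipAt i ε) ⬝ᵥ t := by
        rw [hmax]
        exact sub_le_sub_left (dotProduct_le_supportFn hT _ ht) _
    _ = 2 * signVec ε i * t i := by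
        rw [← sub_dotProduct, signVec_sub_signVec_flipAt, single_dotProduct]

theorem sum_posPart_supportFn_sub_sq_le (hT : Bornology.IsBounded T) (hne : T.Nonempty) {v : ℝ}
    (hv : ∀ t ∈ T, t ⬝ᵥ t ≤ v) (ε : ι → ℤˣ) :
    ∑ i, (supportFn T (signVec ε) - supportFn T (signVec (flipAt i ε)))⁺ ^ 2 ≤ 4 * v := by
  obtain ⟨t, ht, hle⟩ := exists_mem_closure_supportFn_sub_le hT hne ε
  have htv : t ⬝ᵥ t ≤ v :=
    closure_minimal hv (isClosed_le (continuous_id.dotProduct continuous_id) continuous_const) ht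
  calc ∑ i, (supportFn T (signVec ε) - supportFn T (signVec (flipAt i ε)))⁺ ^ 2
      ≤ ∑ i, (2 * signVec ε i * t i) ^ 2 := by
        refine sum_le_sum fun i _ => sq_le_sq.2 ?_
        rw [abs_of_nonneg (posPart_nonneg _)]
        exact sup_le ((hle i).trans (le_abs_self _)) (abs_nonneg _)
    _ = 4 * (t ⬝ᵥ t) := by
        simp only [mul_pow, signVec_sq, dotProduct, mul_sum]
        ring_nf
    _ ≤ 4 * v := by gcongr

theorem supportFn_sub_supportFn_flipAt_le (hne : T.Nonempty) {ζ : ℝ} (hζ : ∀ t ∈ T, ‖t‖ ≤ ζ)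
    (ε : ι → ℤˣ) (i : ι) :
    supportFn T (signVec ε) - supportFn T (signVec (flipAt i ε)) ≤ 2 * ζ := by
  have hT : Bornology.IsBounded T := isBounded_iff_forall_norm_le.2 ⟨ζ, hζ⟩
  obtain ⟨t, ht, hle⟩ := exists_mem_closure_supportFn_sub_le hT hne ε
  have htζ : ‖t‖ ≤ ζ := closure_minimal hζ (isClosed_le continuous_norm continuous_const) ht
  have abs_signVec : |signVec ε i| = 1 := by
    rw [← sq_eq_sq₀ (abs_nonneg _) zero_le_one, sq_abs, signVec_sq, one_pow]
  calc supportFn T (signVec ε) - supportFn T (signVec (flipAt i ε))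
      ≤ |2 * signVec ε i * t i| := (hle i).trans (le_abs_self _)
    _ = 2 * ‖t i‖ := by rw [abs_mul, abs_mul, abs_signVec, mul_one, abs_two, norm_eq_abs]
    _ ≤ 2 * ζ := by
        gcongr
        exact (norm_le_pi_norm t i).trans htζ

theorem dens_supportFn_signVec_le_sub_le_exp (h0 : 0 ∈ T) {ζ v : ℝ} (hζ : ∀ t ∈ T, ‖t‖ ≤ ζ)
    (hv : ∀ t ∈ T, t ⬝ᵥ t ≤ v) (hv0 : 0 < v) {u : ℝ} (hu : 0 < u)
    (huR : u ≤ 𝔼 η : ι → ℤˣ, supportFn T (signVec η)) :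
    (({ε | supportFn T (signVec ε) ≤ 𝔼 η : ι → ℤˣ, supportFn T (signVec η) - u} :
      Finset (ι → ℤˣ)).dens : ℝ) ≤
      exp (-(u ^ 2 / (4 * (ζ * 𝔼 η : ι → ℤˣ, supportFn T (signVec η) + v)))) := by
  have hT : Bornology.IsBounded T := isBounded_iff_forall_norm_le.2 ⟨ζ, hζ⟩
  have hne : T.Nonempty := ⟨0, h0⟩
  have hζ0 : 0 ≤ ζ := by simpa only [norm_zero] using hζ 0 h0
  have hR : 0 < 𝔼 η : ι → ℤˣ, supportFn T (signVec η) := hu.trans_le huR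
  convert dens_le_expect_sub_le_exp (sum_posPart_supportFn_sub_sq_le hT hne hv)
    (supportFn_sub_supportFn_flipAt_le hne hζ) (by positivity) (by positivity) hu huR using 4
  ring

theorem dens_supportFn_signVec_lt_le (h0 : 0 ∈ T) {ζ v : ℝ} (hζ : ∀ t ∈ T, ‖t‖ ≤ ζ)
    (hv : ∀ t ∈ T, t ⬝ᵥ t ≤ v) {δ : ℝ} (hδ : 0 < δ) (hδ1 : δ ≤ 1) :
    (({ε | supportFn T (signVec ε) < 𝔼 η : ι → ℤˣ, supportFn T (signVec η)
      - √(4 * (ζ * 𝔼 η : ι → ℤˣ, supportFn T (signVec η) + v) * log (1 / δ))} :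
        Finset (ι → ℤˣ)).dens : ℝ) ≤ δ := by
  have hY (ε : ι → ℤˣ) : 0 ≤ supportFn T (signVec ε) :=
    supportFn_nonneg (isBounded_iff_forall_norm_le.2 ⟨ζ, hζ⟩) h0 _
  set R := 𝔼 η : ι → ℤˣ, supportFn T (signVec η) with hR
  set u := √(4 * (ζ * R + v) * log (1 / δ)) with hu
  have dens_le_of_nonpos (h : R - u ≤ 0) :
      (({ε | supportFn T (signVec ε) < R - u} : Finset (ι → ℤˣ)).dens : ℝ) ≤ δ := by
    rw [filter_false_of_mem fun ε _ => (h.trans (hY ε)).not_gt, dens_empty, NNRat.cast_zero]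
    exact hδ.le
  have hζ0 : 0 ≤ ζ := by simpa only [norm_zero] using hζ 0 h0
  have hv0 : 0 ≤ v := by simpa only [dotProduct_zero] using hv 0 h0
  rcases hv0.eq_or_lt with rfl | hv0
  · have hR0 : R = 0 := by
      simp only [hR, supportFn_eq_zero_of_dotProduct_self_le_zero ⟨0, h0⟩ hv, expect_const_zero]
    exact dens_le_of_nonpos (sub_nonpos.2 (hR0.trans_le (sqrt_nonneg _)))
  rcases hδ1.eq_or_lt with rfl | hδ1
  · exact_mod_cast dens_le_one
  rcases lt_or_ge R u with hRu | huR
  · exact dens_le_of_nonpos (sub_neg.2 hRu).le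
  have hlog : 0 < log (1 / δ) := log_pos ((one_lt_div hδ).2 hδ1)
  have hR0 : 0 ≤ R := expect_nonneg fun ε _ => hY ε
  have tail := dens_supportFn_signVec_le_sub_le_exp h0 hζ hv hv0 (u := u)
    (sqrt_pos.2 (by positivity)) huR
  have exponent : u ^ 2 / (4 * (ζ * R + v)) = log (1 / δ) := by
    rw [hu, sq_sqrt (by positivity), mul_div_cancel_left₀ _ (by positivity)]
  rw [← hR, exponent, ← log_inv, one_div, inv_inv, exp_log hδ] at tail
  refine le_trans ?_ tail
  gcongr
  exact le_of_lt

end SupportFn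

theorem le_add_sqrt_of_sub_sqrt_le {r R c d : ℝ} (hc : 0 ≤ c) (h : R - √(4 * (c * R + d)) ≤ r) :
    R ≤ r + 2 * c + √((2 * c) ^ 2 + 4 * (c * r + d)) := by
  rcases le_or_gt R (r + 2 * c) with hR | hR
  · exact hR.trans (le_add_of_nonneg_right (Real.sqrt_nonneg _))
  have hrR : 0 < R - r := by linarith
  have hsq : (R - r) ^ 2 ≤ 4 * (c * R + d) := (Real.le_sqrt' hrR).1 (by linarith)
  rw [← sub_le_iff_le_add']
  exact Real.le_sqrt_of_sq_le (by linarith)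

namespace IsRademacherMatrix

open Finset Real

variable {Ω : Type*} [MeasurableSpace Ω] {P : Measure Ω} {n m : ℕ}
  {σ : Fin n → Fin m → Ω → ℝ}

theorem measurableSet_eq (hσ : IsRademacherMatrix σ P) (x : Fin n × Fin m → ℝ) :
    MeasurableSet {ω | (fun p => σ p.1 p.2 ω) = x} :=
  (measurable_pi_lambda _ fun p : Fin n × Fin m => hσ.measurable p.1 p.2)
    (measurableSet_singleton x)

theorem measureReal_eq_signVec (hσ : IsRademacherMatrix σ P) (ε : Fin n × Fin m → ℤˣ) :
    P.real {ω | (fun p => σ p.1 p.2 ω) = signVec ε} =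
      (Fintype.card (Fin n × Fin m → ℤˣ) : ℝ)⁻¹ := by
  have prob_eq (p : Fin n × Fin m) : P (σ p.1 p.2 ⁻¹' {signVec ε p}) = 1 / 2 := by
    change P {ω | σ p.1 p.2 ω = signVec ε p} = 1 / 2
    rcases Int.units_eq_one_or (ε p) with h | h
    · simpa [signVec, h] using hσ.prob_one p.1 p.2
    · simpa [signVec, h] using hσ.prob_neg_one p.1 p.2
  have inter_eq : {ω | (fun p => σ p.1 p.2 ω) = signVec ε} =
      ⋂ p ∈ (univ : Finset (Fin n × Fin m)), σ p.1 p.2 ⁻¹' {signVec ε p} := by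
    ext ω
    simp [funext_iff]
  have indep := hσ.indep.measure_inter_preimage_eq_mul (S := univ) (sets := fun p => {signVec ε p})
    fun p _ => measurableSet_singleton _
  rw [measureReal_def, inter_eq, indep]
  simp [prob_eq, Fintype.card_units_int]

variable [IsProbabilityMeasure P]

theorem ae_eq_one_or_eq_neg_one (hσ : IsRademacherMatrix σ P) (j : Fin n) (i : Fin m) :
    ∀ᵐ ω ∂P, σ j i ω = 1 ∨ σ j i ω = -1 := by
  have measurableSet_eq (c : ℝ) : MeasurableSet {ω | σ j i ω = c} :=
    hσ.measurable j i (measurableSet_singleton c)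
  have disj : Disjoint {ω | σ j i ω = 1} {ω | σ j i ω = -1} := by
    rw [Set.disjoint_left]
    intro ω (h₁ : σ j i ω = 1) (h₂ : σ j i ω = -1)
    linarith
  have prob_union : P ({ω | σ j i ω = 1} ∪ {ω | σ j i ω = -1}) = 1 := by
    rw [measure_union disj (measurableSet_eq _), hσ.prob_one, hσ.prob_neg_one, ENNReal.add_halves]
  exact (mem_ae_iff_prob_eq_one ((measurableSet_eq 1).union (measurableSet_eq (-1)))).2 prob_union

theorem ae_exists_eq_signVec (hσ : IsRademacherMatrix σ P) :
    ∀ᵐ ω ∂P, ∃ ε : Fin n × Fin m → ℤˣ, (fun p => σ p.1 p.2 ω) = signVec ε := by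
  have h : ∀ᵐ ω ∂P, ∀ p : Fin n × Fin m, σ p.1 p.2 ω = 1 ∨ σ p.1 p.2 ω = -1 :=
    ae_all_iff.2 fun p => hσ.ae_eq_one_or_eq_neg_one p.1 p.2
  filter_upwards [h] with ω hω
  have sign_exists (p : Fin n × Fin m) : ∃ u : ℤˣ, σ p.1 p.2 ω = (u : ℤ) := by
    rcases hω p with h | h
    · exact ⟨1, by simpa using h⟩
    · exact ⟨-1, by simpa using h⟩
  choose ε hε using sign_exists
  exact ⟨ε, funext hε⟩

theorem measureReal_le_dens (hσ : IsRademacherMatrix σ P) (q : (Fin n × Fin m → ℝ) → Prop)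
    [DecidablePred q] :
    P.real {ω | q fun p => σ p.1 p.2 ω} ≤
      ({ε | q (signVec ε)} : Finset (Fin n × Fin m → ℤˣ)).dens := by
  set A : Finset (Fin n × Fin m → ℤˣ) := {ε | q (signVec ε)} with hA
  have subset_union : {ω | q fun p => σ p.1 p.2 ω} ≤ᵐ[P]
      ⋃ ε ∈ A, {ω | (fun p => σ p.1 p.2 ω) = signVec ε} := by
    filter_upwards [hσ.ae_exists_eq_signVec] with ω ⟨ε, hε⟩ (hq : q fun p => σ p.1 p.2 ω)
    exact Set.mem_biUnion (x := ε) (by simpa [hA] using hε ▸ hq) hε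
  calc P.real {ω | q fun p => σ p.1 p.2 ω}
      ≤ P.real (⋃ ε ∈ A, {ω | (fun p => σ p.1 p.2 ω) = signVec ε}) :=
        ENNReal.toReal_mono (measure_ne_top _ _) (measure_mono_ae subset_union)
    _ ≤ ∑ ε ∈ A, P.real {ω | (fun p => σ p.1 p.2 ω) = signVec ε} :=
        measureReal_biUnion_finset_le _ _
    _ = A.dens := by
        simp only [hσ.measureReal_eq_signVec, sum_const, nsmul_eq_mul, nnratCast_dens,
          div_eq_mul_inv]

theorem integral_eq_expect (hσ : IsRademacherMatrix σ P) (g : (Fin n × Fin m → ℝ) → ℝ) :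
    ∫ ω, g (fun p => σ p.1 p.2 ω) ∂P = 𝔼 ε, g (signVec ε) := by
  have ae_eq : (fun ω => g fun p => σ p.1 p.2 ω) =ᵐ[P] fun ω => ∑ ε : Fin n × Fin m → ℤˣ,
      {ω | (fun p => σ p.1 p.2 ω) = signVec ε}.indicator (fun _ => g (signVec ε)) ω := by
    filter_upwards [hσ.ae_exists_eq_signVec] with ω ⟨ε, hε⟩
    rw [sum_eq_single_of_mem ε (mem_univ _)]
    · rw [Set.indicator_of_mem (show ω ∈ {ω | (fun p => σ p.1 p.2 ω) = signVec ε} from hε), hε]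
    · intro η _ hη
      refine Set.indicator_of_notMem (fun h => hη ?_) _
      exact signVec_injective (h.symm.trans hε)
  rw [integral_congr_ae ae_eq, integral_finsetSum, expect_eq_sum_div_card, sum_div]
  · refine sum_congr rfl fun ε _ => ?_
    rw [integral_indicator_const _ (hσ.measurableSet_eq _), hσ.measureReal_eq_signVec,
      smul_eq_mul, inv_mul_eq_div, card_univ]
  · exact fun ε _ => (integrable_const _).indicator (hσ.measurableSet_eq _)

theorem one_sub_le_measureReal_integral_supportFn_le (hσ : IsRademacherMatrix σ P)
    {T : Set (Fin n × Fin m → ℝ)} (h0 : 0 ∈ T) {ζ v : ℝ} (hζ : ∀ t ∈ T, ‖t‖ ≤ ζ)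
    (hv : ∀ t ∈ T, t ⬝ᵥ t ≤ v) {δ : ℝ} (hδ : 0 < δ) (hδ1 : δ ≤ 1) :
    1 - δ ≤ P.real {ω | ∫ ω', supportFn T (fun p => σ p.1 p.2 ω') ∂P ≤
      supportFn T (fun p => σ p.1 p.2 ω) + 2 * (ζ * log (1 / δ))
        + √((2 * (ζ * log (1 / δ))) ^ 2
          + 4 * (ζ * log (1 / δ) * supportFn T (fun p => σ p.1 p.2 ω) + v * log (1 / δ)))} := by
  rw [hσ.integral_eq_expect (supportFn T)]
  set R := 𝔼 ε, supportFn T (signVec ε)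
  set good := {ω | R ≤ supportFn T (fun p => σ p.1 p.2 ω) + 2 * (ζ * log (1 / δ))
    + √((2 * (ζ * log (1 / δ))) ^ 2
      + 4 * (ζ * log (1 / δ) * supportFn T (fun p => σ p.1 p.2 ω) + v * log (1 / δ)))}
  set bad := {ω | supportFn T (fun p => σ p.1 p.2 ω) < R - √(4 * (ζ * R + v) * log (1 / δ))}
  have hζ0 : 0 ≤ ζ := by simpa only [norm_zero] using hζ 0 h0
  have hlog : 0 ≤ log (1 / δ) := log_nonneg ((one_le_div hδ).2 hδ1)
  have cover : Set.univ ⊆ bad ∪ good := by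
    intro ω _
    refine or_iff_not_imp_left.2 fun h => ?_
    refine le_add_sqrt_of_sub_sqrt_le (mul_nonneg hζ0 hlog) ((le_of_eq ?_).trans (not_lt.1 h))
    ring_nf
  have bad_le : P.real bad ≤ δ := (hσ.measureReal_le_dens fun x => supportFn T x < _).trans
    (dens_supportFn_signVec_lt_le h0 hζ hv hδ hδ1)
  have total : P.real Set.univ ≤ P.real bad + P.real good :=
    (measureReal_mono cover).trans (measureReal_union_le bad good)
  rw [probReal_univ] at total
  linarith

end IsRademacherMatrix

section MonteCarlo

open Finset Real

theorem sum_ciSup_eq_ciSup_sum {ι : Type*} [Fintype ι] {κ : ι → Type*} [∀ i, Nonempty (κ i)]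
    {a : ∀ i, κ i → ℝ} (ha : ∀ i, BddAbove (Set.range (a i))) :
    ∑ i, ⨆ k, a i k = ⨆ φ : ∀ i, κ i, ∑ i, a i (φ i) := by
  have sum_le (φ : ∀ i, κ i) : ∑ i, a i (φ i) ≤ ∑ i, ⨆ k, a i k :=
    sum_le_sum fun i _ => le_ciSup (ha i) (φ i)
  refine le_antisymm ?_ (ciSup_le sum_le)
  have seq_exists (i : ι) : ∃ φ : ℕ → κ i,
      Filter.Tendsto (fun N => a i (φ N)) Filter.atTop (nhds (⨆ k, a i k)) := by
    obtain ⟨u, -, hu, hmem⟩ := exists_seq_tendsto_sSup (Set.range_nonempty (a i)) (ha i)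
    choose φ hφ using hmem
    exact ⟨φ, by simpa only [hφ, iSup] using hu⟩
  choose φ hφ using seq_exists
  exact le_of_tendsto' (tendsto_finsetSum univ fun i _ => hφ i) fun N =>
    le_ciSup (f := fun φ : ∀ i, κ i => ∑ i, a i (φ i)) ⟨_, Set.forall_mem_range.2 sum_le⟩
      fun i => φ i N

variable {X : Type*} {n m : ℕ} {F : Set (X → ℝ)} {s : Fin m → X}

theorem abs_le_empSup (hbdd : BddAbove (Set.range fun p : Fin m × F => |(p.2 : X → ℝ) (s p.1)|))
    (f : F) (i : Fin m) : |(f : X → ℝ) (s i)| ≤ empSup F s :=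
  le_ciSup hbdd (i, f)

theorem empSup_nonneg : 0 ≤ empSup F s :=
  Real.iSup_nonneg fun _ => abs_nonneg _

theorem sum_sq_le_mul_empWimpyVar (hm : 0 < m)
    (hbdd : BddAbove (Set.range fun p : Fin m × F => |(p.2 : X → ℝ) (s p.1)|)) (f : F) :
    ∑ i, (f : X → ℝ) (s i) ^ 2 ≤ m * empWimpyVar F s := by
  have hle : ∑ i, (f : X → ℝ) (s i) ^ 2 ≤ ⨆ g : F, ∑ i, (g : X → ℝ) (s i) ^ 2 := by
    refine le_ciSup (f := fun g : F => ∑ i, (g : X → ℝ) (s i) ^ 2)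
      ⟨∑ _ : Fin m, empSup F s ^ 2, ?_⟩ f
    rintro _ ⟨g, rfl⟩
    exact sum_le_sum fun i _ => sq_le_sq.2 <|
      (abs_le_empSup hbdd g i).trans (le_abs_self _)
  rwa [empWimpyVar, ← mul_assoc, mul_one_div_cancel (by positivity), one_mul]

theorem empWimpyVar_le_empSup_mul_empAbs
    (hbdd : BddAbove (Set.range fun p : Fin m × F => |(p.2 : X → ℝ) (s p.1)|)) :
    empWimpyVar F s ≤ empSup F s * empAbs F s := by
  have sum_abs_le (f : F) :
      ∑ i, |(f : X → ℝ) (s i)| ≤ ⨆ g : F, ∑ i, |(g : X → ℝ) (s i)| := by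
    refine le_ciSup (f := fun g : F => ∑ i, |(g : X → ℝ) (s i)|)
      ⟨∑ _ : Fin m, empSup F s, ?_⟩ f
    rintro _ ⟨g, rfl⟩
    exact sum_le_sum fun i _ => abs_le_empSup hbdd g i
  rw [empWimpyVar, empAbs, mul_left_comm]
  refine mul_le_mul_of_nonneg_left ?_ (by positivity)
  refine Real.iSup_le (fun f => ?_) (mul_nonneg empSup_nonneg
    (Real.iSup_nonneg fun _ => sum_nonneg fun _ _ => abs_nonneg _))
  calc ∑ i, (f : X → ℝ) (s i) ^ 2
      ≤ ∑ i, empSup F s * |(f : X → ℝ) (s i)| := by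
        refine sum_le_sum fun i _ => ?_
        rw [← sq_abs, sq]
        exact mul_le_mul_of_nonneg_right (abs_le_empSup hbdd f i) (abs_nonneg _)
    _ ≤ empSup F s * ⨆ g : F, ∑ i, |(g : X → ℝ) (s i)| := by
        rw [← mul_sum]
        exact mul_le_mul_of_nonneg_left (sum_abs_le f) empSup_nonneg

/-- The set of vectors whose support function is the `n`-Monte Carlo empirical Rademacher average.
Such a vector lists the values on the sample of one function of `F` for each of the `n` trials,
scaled by `1 / (n * m)`. -/
def mceraVectors (n : ℕ) (F : Set (X → ℝ)) (s : Fin m → X) : Set (Fin n × Fin m → ℝ) :=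
  Set.range fun (φ : Fin n → F) p => (φ p.1 : X → ℝ) (s p.2) / (n * m)

theorem zero_mem_mceraVectors (hF0 : (fun _ => 0) ∈ F) : 0 ∈ mceraVectors n F s :=
  ⟨fun _ => ⟨_, hF0⟩, by funext p; simp⟩

theorem supportFn_mceraVectors (hF : F.Nonempty)
    (hbdd : BddAbove (Set.range fun p : Fin m × F => |(p.2 : X → ℝ) (s p.1)|))
    (σ : Fin n → Fin m → ℝ) :
    supportFn (mceraVectors n F s) (fun p => σ p.1 p.2) = mcera F s σ := by
  have := hF.to_subtype
  have correlation_bddAbove (j : Fin n) :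
      BddAbove (Set.range fun f : F => (1 / (m : ℝ)) * ∑ i, σ j i * (f : X → ℝ) (s i)) := by
    refine ⟨(1 / (m : ℝ)) * ∑ i, |σ j i| * empSup F s, ?_⟩
    rintro _ ⟨f, rfl⟩
    refine mul_le_mul_of_nonneg_left (sum_le_sum fun i _ => ?_) (by positivity)
    refine (le_abs_self _).trans ?_
    rw [abs_mul]
    exact mul_le_mul_of_nonneg_left (abs_le_empSup hbdd f i) (abs_nonneg _)
  rw [mcera, sum_ciSup_eq_ciSup_sum correlation_bddAbove, Real.mul_iSup_of_nonneg (by positivity),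
    supportFn, mceraVectors, iSup_range' (fun t : Fin n × Fin m → ℝ => (fun p => σ p.1 p.2) ⬝ᵥ t)]
  refine iSup_congr fun φ => ?_
  simp only [dotProduct, Fintype.sum_prod_type, mul_sum]
  refine sum_congr rfl fun j _ => sum_congr rfl fun i _ => ?_
  field_simp

theorem norm_le_of_mem_mceraVectors
    (hbdd : BddAbove (Set.range fun p : Fin m × F => |(p.2 : X → ℝ) (s p.1)|))
    {t : Fin n × Fin m → ℝ} (ht : t ∈ mceraVectors n F s) : ‖t‖ ≤ empSup F s / (n * m) := by
  obtain ⟨φ, rfl⟩ := ht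
  refine (pi_norm_le_iff_of_nonneg (div_nonneg empSup_nonneg (by positivity))).2 fun p => ?_
  rw [norm_eq_abs, abs_div, abs_of_nonneg (by positivity : (0 : ℝ) ≤ n * m)]
  exact div_le_div_of_nonneg_right (abs_le_empSup hbdd _ _) (by positivity)

theorem dotProduct_self_le_of_mem_mceraVectors (hn : 0 < n) (hm : 0 < m)
    (hbdd : BddAbove (Set.range fun p : Fin m × F => |(p.2 : X → ℝ) (s p.1)|))
    {t : Fin n × Fin m → ℝ} (ht : t ∈ mceraVectors n F s) :
    t ⬝ᵥ t ≤ empWimpyVar F s / (n * m) := by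
  obtain ⟨φ, rfl⟩ := ht
  calc (fun p : Fin n × Fin m => (φ p.1 : X → ℝ) (s p.2) / (n * m)) ⬝ᵥ
        (fun p => (φ p.1 : X → ℝ) (s p.2) / (n * m))
      = (∑ j, ∑ i, (φ j : X → ℝ) (s i) ^ 2) / (n * m : ℝ) ^ 2 := by
        simp only [dotProduct, Fintype.sum_prod_type, sum_div, ← sq, div_pow]
    _ ≤ (∑ _ : Fin n, m * empWimpyVar F s) / (n * m : ℝ) ^ 2 := by
        gcongr
        exact sum_sq_le_mul_empWimpyVar hm hbdd _
    _ = empWimpyVar F s / (n * m) := by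
        rw [sum_const, card_univ, Fintype.card_fin, nsmul_eq_mul, ← mul_assoc, sq,
          mul_div_mul_left _ _ (by positivity)]

variable {Ω : Type*} [MeasurableSpace Ω] {P : Measure Ω} [IsProbabilityMeasure P]
  {σ : Fin n → Fin m → Ω → ℝ}

theorem one_sub_le_measureReal_era_le (hn : 0 < n) (hm : 0 < m) (hσ : IsRademacherMatrix σ P)
    (hF0 : (fun _ => 0) ∈ F)
    (hbdd : BddAbove (Set.range fun p : Fin m × F => |(p.2 : X → ℝ) (s p.1)|))
    {w : ℝ} (hw : empWimpyVar F s ≤ w) {δ : ℝ} (hδ : 0 < δ) (hδ1 : δ ≤ 1) :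
    1 - δ ≤ P.real {ω | era F s σ P ≤
      mcera F s (fun j i => σ j i ω)
      + 2 * empSup F s * log (1 / δ) / (n * m)
      + √((2 * empSup F s * log (1 / δ) / (n * m)) ^ 2
          + 4 * (empSup F s * mcera F s (fun j i => σ j i ω) + w) * log (1 / δ) / (n * m))} := by
  have h := hσ.one_sub_le_measureReal_integral_supportFn_le (zero_mem_mceraVectors hF0)
    (fun t ht => norm_le_of_mem_mceraVectors hbdd ht)
    (fun t ht => (dotProduct_self_le_of_mem_mceraVectors hn hm hbdd ht).trans
      (div_le_div_of_nonneg_right hw (by positivity))) hδ hδ1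
  have supportFn_eq (ω : Ω) : supportFn (mceraVectors n F s) (fun p => σ p.1 p.2 ω) =
      mcera F s fun j i => σ j i ω :=
    supportFn_mceraVectors ⟨_, hF0⟩ hbdd fun j i => σ j i ω
  have integral_eq :
      ∫ ω, supportFn (mceraVectors n F s) (fun p => σ p.1 p.2 ω) ∂P = era F s σ P := by
    simp only [supportFn_eq, era]
  rw [integral_eq] at h
  simp only [supportFn_eq] at h
  convert h using 9 <;> ring

end MonteCarlo

theorem mainTheorem3_general {X Ω : Type*} [MeasurableSpace Ω] (P : Measure Ω)
    [IsProbabilityMeasure P] (n m : ℕ) (hn : 0 < n) (hm : 0 < m)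
    (F : Set (X → ℝ)) (hF0 : (fun _ => 0) ∈ F) (s : Fin m → X)
    (hbdd : BddAbove (Set.range fun p : Fin m × F => |(p.2 : X → ℝ) (s p.1)|))
    (σ : Fin n → Fin m → Ω → ℝ) (hσ : IsRademacherMatrix σ P)
    (δ : ℝ) (hδ : 0 < δ) (hδ1 : δ ≤ 1) :
    (1 - δ ≤ P.real {ω | era F s σ P ≤
        mcera F s (fun j i => σ j i ω)
        + 2 * empSup F s * Real.log (1 / δ) / (n * m)
        + √((2 * empSup F s * Real.log (1 / δ) / (n * m)) ^ 2
            + 4 * empSup F s * (mcera F s (fun j i => σ j i ω) + empAbs F s)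
                * Real.log (1 / δ) / (n * m))}) ∧
    (1 - δ ≤ P.real {ω | era F s σ P ≤
        mcera F s (fun j i => σ j i ω)
        + 2 * empSup F s * Real.log (1 / δ) / (n * m)
        + √((2 * empSup F s * Real.log (1 / δ) / (n * m)) ^ 2
            + 4 * (empSup F s * mcera F s (fun j i => σ j i ω) + empWimpyVar F s)
                * Real.log (1 / δ) / (n * m))}) := by
  refine ⟨?_, one_sub_le_measureReal_era_le hn hm hσ hF0 hbdd le_rfl hδ hδ1⟩
  simpa only [mul_assoc, mul_add] using
    one_sub_le_measureReal_era_le hn hm hσ hF0 hbdd (empWimpyVar_le_empSup_mul_empAbs hbdd) hδ hδ1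

theorem mainTheorem3 {X Ω : Type*} [MeasurableSpace Ω] (P : Measure Ω) [IsProbabilityMeasure P]
    (n m : ℕ) (hn : 0 < n) (hm : 0 < m)
    (a b : ℝ) (ha : a ≤ 0) (hb : 0 < b)
    (F : Set (X → ℝ)) (hF : ∀ f ∈ F, ∀ x, f x ∈ Set.Icc a b) (hF0 : (fun _ => 0) ∈ F)
    (s : Fin m → X)
    (σ : Fin n → Fin m → Ω → ℝ) (hσ : IsRademacherMatrix σ P)
    (δ : ℝ) (hδ : 0 < δ) (hδ1 : δ ≤ 1) :
    (1 - δ ≤ P.real {ω | era F s σ P ≤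
        mcera F s (fun j i => σ j i ω)
        + 2 * empSup F s * Real.log (1 / δ) / (n * m)
        + √((2 * empSup F s * Real.log (1 / δ) / (n * m)) ^ 2
            + 4 * empSup F s * (mcera F s (fun j i => σ j i ω) + empAbs F s)
                * Real.log (1 / δ) / (n * m))}) ∧
    (1 - δ ≤ P.real {ω | era F s σ P ≤
        mcera F s (fun j i => σ j i ω)
        + 2 * empSup F s * Real.log (1 / δ) / (n * m)
        + √((2 * empSup F s * Real.log (1 / δ) / (n * m)) ^ 2
            + 4 * (empSup F s * mcera F s (fun j i => σ j i ω) + empWimpyVar F s)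
                * Real.log (1 / δ) / (n * m))}) := by
  refine mainTheorem3_general P n m hn hm F hF0 s ⟨max |a| |b|, ?_⟩ σ hσ δ hδ hδ1
  rintro _ ⟨⟨i, f⟩, rfl⟩
  exact abs_le_max_abs_abs (hF f f.2 (s i)).1 (hF f f.2 (s i)).2
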